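/- For $\tau\in\mathbb{C}$ with $\operatorname{Im}\tau>0$ and $q^{r}:=e^{2\pi i r\tau}$ put $$\lambda(\tau):=16\,q^{1/2}\prod_{n=1}^{\infty}\frac{(1+q^{n})^{8}}{(1+q^{n-1/2})^{8}},\qquad j(\tau):=2^{8}\,\frac{(1-\lambda(\tau)+\lambda(\tau)^{2})^{3}}{\lambda(\tau)^{2}(1-\lambda(\tau))^{2}}.$$ For real $d>0$ let $\sqrt{-d}:=i\sqrt d$ and $j_d:=j\left(\frac{1+\sqrt{-d}}{2}\right)$. Taking principal values of all complex square and cube roots, put $$\beta_d:=\sqrt{1728j_d^{2}-j_d^{3}},$$ $$t_d:=-\tfrac{1}{768}\left(\left(-884736j_d+2304j_d^{2}-j_d^{3}-12288\sqrt3\,\beta_d\right)^{1/3}+\left(-884736j_d+2304j_d^{2}-j_d^{3}+12288\sqrt3\,\beta_d\right)^{1/3}\right),$$ $$a_d:=\tfrac{1}{48}\left(\sqrt{1728-j_d}+\left(\beta_d-24\sqrt3\,j_d\right)^{1/3}+\left(\beta_d+24\sqrt3\,j_d\right)^{1/3}\right),$$ $$b_d:=\tfrac{1}{48}\sqrt{\left(\sqrt3\left(\left(\beta_d-24\sqrt3\,j_d\right)^{1/3}-\left(\beta_d+24\sqrt3\,j_d\right)^{1/3}\right)+24\right)^{2}+1152-9j_d},$$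 $$c_d:=\tfrac{1}{48}\sqrt{-2304\,t_d+1728-3j_d}.$$ Then for every real $d\ge 3$ the numbers $a_d$, $b_d$, $c_d$ are real, and for each $x\in\{a_d,b_d,c_d\}$ $$\lambda\left(\tfrac{1+\sqrt{-d}}{2}\right)=\frac{1}{\frac12-ix},\qquad \lambda\left(\tfrac{\sqrt{-d}-1}{\sqrt{-d}+1}\right)=\frac12+ix,\qquad \lambda\left(\tfrac{2}{1-\sqrt{-d}}\right)=\frac{ix-\frac12}{ix+\frac12},$$ $$\lambda\left(-\tfrac{2}{1+\sqrt{-d}}\right)=\frac{ix+\frac12}{ix-\frac12},\qquad \lambda\left(-\tfrac{\sqrt{-d}+1}{\sqrt{-d}-1}\right)=\frac12-ix,\qquad \lambda\left(\tfrac{-1+\sqrt{-d}}{2}\right)=\frac{1}{\frac12+ix}.$$ -/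

import Mathlib

noncomputable section

namespace EllipticLambda

/-- The elliptic lambda function
`λ(τ) = 16 q^(1/2) ∏_{n ≥ 1} (1 + q^n)^8 / (1 + q^(n - 1/2))^8`, `q^r = exp (2 π i r τ)`,
for `τ` in the upper half plane. The index `n : ℕ` below stands for `n + 1`. -/
def lam (τ : ℂ) : ℂ :=
  16 * Complex.exp (2 * Real.pi * Complex.I * (1 / 2) * τ) *
    ∏' n : ℕ, (1 + Complex.exp (2 * Real.pi * Complex.I * ((n : ℂ) + 1) * τ)) ^ 8 /
      (1 + Complex.exp (2 * Real.pi * Complex.I * ((n : ℂ) + 1 / 2) * τ)) ^ 8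

/-- The elliptic modular function `j(τ)`. -/
def j (τ : ℂ) : ℂ :=
  2 ^ 8 * (1 - lam τ + lam τ ^ 2) ^ 3 / (lam τ ^ 2 * (1 - lam τ) ^ 2)

/-- `√(-d) = i √d` for a real number `d ≥ 0`. -/
def sqrtNeg (d : ℝ) : ℂ := Complex.I * (Real.sqrt d : ℂ)

/-- The principal complex square root. -/
def sqrtC (z : ℂ) : ℂ := z ^ (1 / 2 : ℂ)

/-- The principal complex cube root. -/
def cbrtC (z : ℂ) : ℂ := z ^ (1 / 3 : ℂ)

/-- `j_d = j((1 + √(-d)) / 2)`. -/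
def jd (d : ℝ) : ℂ := j ((1 + sqrtNeg d) / 2)

/-- `β_d`. -/
def betad (d : ℝ) : ℂ := sqrtC (1728 * jd d ^ 2 - jd d ^ 3)

/-- `t_d`. -/
def td (d : ℝ) : ℂ :=
  -(1 / 768) *
    (cbrtC (-884736 * jd d + 2304 * jd d ^ 2 - jd d ^ 3 - 12288 * (Real.sqrt 3 : ℂ) * betad d)
      + cbrtC (-884736 * jd d + 2304 * jd d ^ 2 - jd d ^ 3 + 12288 * (Real.sqrt 3 : ℂ) * betad d))

/-- `a_d`. -/
def ad (d : ℝ) : ℂ :=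
  1 / 48 * (sqrtC (1728 - jd d)
    + cbrtC (betad d - 24 * (Real.sqrt 3 : ℂ) * jd d)
    + cbrtC (betad d + 24 * (Real.sqrt 3 : ℂ) * jd d))

/-- `b_d`. -/
def bd (d : ℝ) : ℂ :=
  1 / 48 * sqrtC (((Real.sqrt 3 : ℂ) *
      (cbrtC (betad d - 24 * (Real.sqrt 3 : ℂ) * jd d)
        - cbrtC (betad d + 24 * (Real.sqrt 3 : ℂ) * jd d)) + 24) ^ 2
    + 1152 - 9 * jd d)

/-- `c_d`. -/
def cd (d : ℝ) : ℂ :=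
  1 / 48 * sqrtC (-2304 * td d + 1728 - 3 * jd d)

end EllipticLambda

end

noncomputable section

namespace EllipticLambda

open Complex Filter Topology Finset

/-! Let τ = (1 + √-d)/2 and L = λ(τ). Since Re τ = 1/2, the reflection -τ̄ equals τ - 1, so L̄ = λ(τ
- 1) = L/(L - 1) (`conj_lam_half_one_add_sqrtNeg`). Hence |L|² = 2 Re L, that is, Re(1/L) = 1/2, and
1/L = 1/2 - ix for a real x.

The algebra needs x ≥ √3/2. The nome of τ is ip with p = exp(-π√d/2). For d ≥ 3 it is small enough
that Im L > 0 (`lam_im_pos`) and that |L| grows with p (`norm_lam_mono`). At d = 3 the relation -1/τ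
= τ - 1 forces |L| = 1. So |L| ≤ 1, and 1/4 + x² = 1/|L|² ≥ 1 with x > 0.

Now j_d is a rational function of x, and every radicand in a_d, b_d, c_d is an exact square or cube
of a real number that is nonnegative once x ≥ √3/2. Principal roots therefore select that number,
and all three expressions collapse to x. The other five arguments come from τ by translations and
inversion.

These transformation laws rest on λ = θ₂⁴/θ₃⁴ (`lam_eq_jacobiTheta₂`), which follows from the Jacobi
triple product, and on θ₃⁴ = θ₂⁴ + θ₄⁴. -/

/-! ### Gaussian binomials and the Jacobi triple product. -/

/-- The Gaussian binomial coefficient, by its Pascal recursion. -/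
def gaussBinom (q : ℂ) : ℕ → ℕ → ℂ
  | _, 0 => 1
  | 0, _ + 1 => 0
  | n + 1, k + 1 => gaussBinom q n k + q ^ (k + 1) * gaussBinom q n (k + 1)

@[simp] lemma gaussBinom_zero_right (q : ℂ) (n : ℕ) : gaussBinom q n 0 = 1 := by
  cases n <;> rfl

lemma gaussBinom_succ_succ (q : ℂ) (n k : ℕ) :
    gaussBinom q (n + 1) (k + 1) = gaussBinom q n k + q ^ (k + 1) * gaussBinom q n (k + 1) := rfl

lemma gaussBinom_eq_zero_of_lt (q : ℂ) {n k : ℕ} (h : n < k) : gaussBinom q n k = 0 := by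
  induction n generalizing k with
  | zero => obtain ⟨k, rfl⟩ := Nat.exists_eq_succ_of_ne_zero h.ne'; rfl
  | succ n ih =>
    obtain ⟨k, rfl⟩ := Nat.exists_eq_succ_of_ne_zero (by omega : k ≠ 0)
    rw [Nat.succ_eq_add_one, gaussBinom_succ_succ, ih (by omega), ih (by omega)]
    simp

/-- The q-binomial theorem. -/
theorem prod_one_add_pow_mul (q x : ℂ) (n : ℕ) :
    ∏ k ∈ range n, (1 + q ^ k * x) =
      ∑ k ∈ range (n + 1), gaussBinom q n k * q ^ (k.choose 2) * x ^ k := by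
  induction n generalizing x with
  | zero => simp
  | succ n ih =>
    have h1 : ∏ k ∈ range (n + 1), (1 + q ^ k * x) =
        (1 + x) * ∏ k ∈ range n, (1 + q ^ k * (q * x)) := by
      rw [prod_range_succ']
      simp only [pow_zero, one_mul]
      rw [mul_comm]
      congr 1
      exact prod_congr rfl fun k _ => by ring
    -- The added top term is zero, because `gaussBinom q n (n + 1)` vanishes; it keeps the ranges
    -- equal for the Pascal recursion.
    have h2 : ∑ k ∈ range (n + 1), gaussBinom q n k * q ^ (k.choose 2) * (q * x) ^ k =
        ∑ k ∈ range (n + 1), gaussBinom q n (k + 1) * q ^ ((k + 1).choose 2) * (q * x) ^ (k + 1)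
          + 1 := by
      rw [sum_range_succ', sum_range_succ (fun k =>
        gaussBinom q n (k + 1) * q ^ ((k + 1).choose 2) * (q * x) ^ (k + 1)),
        gaussBinom_eq_zero_of_lt q (Nat.lt_succ_self n)]
      simp
    rw [h1, ih, sum_range_succ' _ (n + 1), add_mul, one_mul]
    nth_rewrite 1 [h2]
    rw [mul_sum, add_right_comm, ← sum_add_distrib]
    congr 1
    · refine sum_congr rfl fun k _ => ?_
      rw [gaussBinom_succ_succ, Nat.choose_succ_succ' k 1, Nat.choose_one_right]
      ring
    · simp

/-- The finite product `(1 - q) (1 - q ^ 2) ⋯ (1 - q ^ n)`. -/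
def qFactorial (q : ℂ) (n : ℕ) : ℂ := ∏ k ∈ range n, (1 - q ^ (k + 1))

lemma qFactorial_succ (q : ℂ) (n : ℕ) :
    qFactorial q (n + 1) = qFactorial q n * (1 - q ^ (n + 1)) := prod_range_succ _ _

/-- The factorial formula is kept free of division, so the induction also covers roots of unity q.
-/
lemma gaussBinom_mul_qFactorial (q : ℂ) (j k : ℕ) :
    gaussBinom q (j + k) j * qFactorial q j * qFactorial q k = qFactorial q (j + k) := by
  obtain ⟨n, hn⟩ : ∃ n, n = j + k := ⟨_, rfl⟩
  induction n generalizing j k with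
  | zero =>
    obtain ⟨rfl, rfl⟩ : j = 0 ∧ k = 0 := by omega
    simp [qFactorial]
  | succ n ih =>
    rcases j with _ | j
    · simp [qFactorial]
    have h1 := ih j k (by omega)
    rw [show j + 1 + k = j + k + 1 by omega, gaussBinom_succ_succ, qFactorial_succ q (j + k),
      ← h1, qFactorial_succ]
    rcases k with _ | k
    · rw [gaussBinom_eq_zero_of_lt q (by omega : j + 0 < j + 1)]
      simp [qFactorial]
      ring
    · have h2 := ih (j + 1) k (by omega)
      rw [show j + 1 + k = j + (k + 1) by omega, ← h1, qFactorial_succ] at h2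
      rw [qFactorial_succ q k] at h2 ⊢
      linear_combination q ^ (j + 1) * (1 - q ^ (k + 1)) * h2

lemma norm_pow_succ_lt_one {q : ℂ} (hq : ‖q‖ < 1) (k : ℕ) : ‖q ^ (k + 1)‖ < 1 := by
  rw [norm_pow]
  exact pow_lt_one₀ (norm_nonneg _) hq (Nat.succ_ne_zero k)

lemma one_sub_pow_succ_ne_zero {q : ℂ} (hq : ‖q‖ < 1) (k : ℕ) : 1 - q ^ (k + 1) ≠ 0 := by
  intro h
  have := norm_pow_succ_lt_one hq k
  rw [← sub_eq_zero.mp h] at this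
  simp at this

lemma qFactorial_ne_zero {q : ℂ} (hq : ‖q‖ < 1) (n : ℕ) : qFactorial q n ≠ 0 :=
  prod_ne_zero_iff.mpr fun k _ => one_sub_pow_succ_ne_zero hq k

lemma tendsto_qFactorial {q : ℂ} (hq : ‖q‖ < 1) :
    Tendsto (qFactorial q) atTop (𝓝 (∏' k : ℕ, (1 - q ^ (k + 1)))) :=
  (ModularForm.multipliable_one_sub_pow hq).hasProd.tendsto_prod_nat

lemma tprod_one_sub_pow_ne_zero {q : ℂ} (hq : ‖q‖ < 1) : ∏' k : ℕ, (1 - q ^ (k + 1)) ≠ 0 := by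
  have hs : Summable fun k : ℕ => ‖-q ^ (k + 1)‖ := by
    simp only [norm_neg, norm_pow]
    exact (summable_nat_add_iff 1).mpr (summable_geometric_of_lt_one (norm_nonneg _) hq)
  simpa [sub_eq_add_neg] using
    tprod_one_add_ne_zero_of_summable (f := fun k : ℕ => -q ^ (k + 1))
      (fun k => by simpa [sub_eq_add_neg] using one_sub_pow_succ_ne_zero hq k) hs

lemma gaussBinom_eq_div {q : ℂ} (hq : ‖q‖ < 1) {n k : ℕ} (h : k ≤ n) :
    gaussBinom q n k = qFactorial q n * (qFactorial q k)⁻¹ * (qFactorial q (n - k))⁻¹ := by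
  have := gaussBinom_mul_qFactorial q k (n - k)
  rw [Nat.add_sub_cancel' h] at this
  rw [← this]
  field_simp [qFactorial_ne_zero hq]

/-- The q-factorials converge to a nonzero limit, so they and their inverses are bounded. This
uniform bound provides the dominating series for the triple product. -/
lemma exists_norm_gaussBinom_le {q : ℂ} (hq : ‖q‖ < 1) :
    ∃ C : ℝ, ∀ n k, ‖gaussBinom q n k‖ ≤ C := by
  obtain ⟨A, hA⟩ := (Metric.isBounded_range_of_tendsto _ (tendsto_qFactorial hq)).exists_norm_le
  obtain ⟨B, hB⟩ := (Metric.isBounded_range_of_tendsto _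
    ((tendsto_qFactorial hq).inv₀ (tprod_one_sub_pow_ne_zero hq))).exists_norm_le
  have hA' n : ‖qFactorial q n‖ ≤ A := hA _ ⟨n, rfl⟩
  have hB' n : ‖(qFactorial q n)⁻¹‖ ≤ B := hB _ ⟨n, rfl⟩
  have hA0 : 0 ≤ A := (norm_nonneg _).trans (hA' 0)
  have hB0 : 0 ≤ B := (norm_nonneg _).trans (hB' 0)
  refine ⟨A * B * B, fun n k => ?_⟩
  rcases le_or_gt k n with h | h
  · rw [gaussBinom_eq_div hq h, norm_mul, norm_mul]
    gcongr <;> simp only [hA', hB']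
  · rw [gaussBinom_eq_zero_of_lt q h, norm_zero]
    positivity

lemma tendsto_gaussBinom_central {q : ℂ} (hq : ‖q‖ < 1) (n : ℤ) :
    Tendsto (fun N : ℕ => gaussBinom q (2 * N) (n + N).toNat) atTop
      (𝓝 (∏' k : ℕ, (1 - q ^ (k + 1)))⁻¹) := by
  have h0 := tprod_one_sub_pow_ne_zero hq
  have hF := tendsto_qFactorial hq
  have e1 : Tendsto (fun N : ℕ => 2 * N) atTop atTop :=
    tendsto_atTop_mono (fun N => (by omega : N ≤ 2 * N)) tendsto_id
  have e2 : Tendsto (fun N : ℕ => (n + N).toNat) atTop atTop :=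
    tendsto_atTop.mpr fun b => eventually_atTop.mpr ⟨b + n.natAbs, fun N _ => by omega⟩
  have e3 : Tendsto (fun N : ℕ => 2 * N - (n + N).toNat) atTop atTop :=
    tendsto_atTop.mpr fun b => eventually_atTop.mpr ⟨b + n.natAbs, fun N _ => by omega⟩
  have := ((hF.comp e1).mul ((hF.comp e2).inv₀ h0)).mul ((hF.comp e3).inv₀ h0)
  rw [mul_inv_cancel₀ h0, one_mul] at this
  refine this.congr' (eventually_atTop.mpr ⟨n.natAbs, fun N hN => ?_⟩)
  exact (gaussBinom_eq_div hq (by omega : (n + N).toNat ≤ 2 * N)).symm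

/-- The finite form of the Jacobi triple product. -/
theorem prod_jacobi_finite {Q w : ℂ} (hQ : Q ≠ 0) (hw : w ≠ 0) (N : ℕ) :
    ∏ k ∈ range N, (1 + Q ^ (2 * k + 1) * w) * (1 + Q ^ (2 * k + 1) * w⁻¹) =
      ∑ k ∈ range (2 * N + 1), gaussBinom (Q ^ 2) (2 * N) k *
        (Q ^ (((k : ℤ) - N) ^ 2) * w ^ ((k : ℤ) - N)) := by
  have hfac : ∀ N : ℕ, ∏ k ∈ range N, (Q ^ (2 * k + 1) * w⁻¹) = Q ^ (N ^ 2) * (w ^ N)⁻¹ := by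
    intro N
    induction N with
    | zero => simp
    | succ N ih =>
      rw [prod_range_succ, ih]
      field_simp
      ring
  -- Pulling Q^(2k+1) w⁻¹ out of each factor and reversing the order turns all 2N factors into one
  -- progression of ratio Q² starting at Q^(1-2N) w, ready for the q-binomial theorem.
  have hleft : ∏ k ∈ range N, (1 + Q ^ (2 * k + 1) * w⁻¹) = Q ^ (N ^ 2) * (w ^ N)⁻¹ *
      ∏ k ∈ range N, (1 + (Q ^ 2) ^ k * (Q ^ (1 - 2 * (N : ℤ)) * w)) := by
    rw [← hfac, ← prod_range_reflect (fun k => 1 + (Q ^ 2) ^ k * (Q ^ (1 - 2 * (N : ℤ)) * w)),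
      ← prod_mul_distrib]
    refine prod_congr rfl fun k hk => ?_
    have hk' : k < N := mem_range.mp hk
    have : (Q ^ 2) ^ (N - 1 - k) * Q ^ (1 - 2 * (N : ℤ)) = (Q ^ (2 * k + 1))⁻¹ := by
      rw [← pow_mul, ← zpow_natCast, ← zpow_natCast, ← zpow_add₀ hQ, ← zpow_neg]
      congr 1
      push_cast [Nat.cast_sub (show k ≤ N - 1 by omega), Nat.cast_sub (show 1 ≤ N by omega)]
      ring
    rw [← mul_assoc, this]
    field_simp
    ring
  have hright : ∏ k ∈ range N, (1 + Q ^ (2 * k + 1) * w) =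
      ∏ k ∈ range N, (1 + (Q ^ 2) ^ (N + k) * (Q ^ (1 - 2 * (N : ℤ)) * w)) := by
    refine prod_congr rfl fun k _ => ?_
    rw [← mul_assoc]
    congr 2
    rw [← pow_mul, ← zpow_natCast, ← zpow_natCast, ← zpow_add₀ hQ]
    congr 1
    push_cast
    ring
  rw [prod_mul_distrib, hleft, hright, mul_comm, mul_assoc, ← prod_range_add, ← two_mul,
    prod_one_add_pow_mul, mul_sum]
  refine sum_congr rfl fun k _ => ?_
  have hc : ((k.choose 2 : ℕ) : ℤ) * 2 = k * (k - 1) := by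
    have h : k.choose 2 * 2 = k * (k - 1) := by
      rw [Nat.choose_two_right, Nat.div_mul_cancel (Nat.even_mul_pred_self k).two_dvd]
    have h' : ((k.choose 2 : ℕ) : ℤ) * 2 = ((k * (k - 1) : ℕ) : ℤ) := by exact_mod_cast h
    rw [h']
    rcases k with _ | k <;> simp
  have hQe : Q ^ (N ^ 2) * (Q ^ 2) ^ (k.choose 2) * (Q ^ (1 - 2 * (N : ℤ))) ^ k =
      Q ^ (((k : ℤ) - N) ^ 2) := by
    rw [← pow_mul, ← zpow_natCast, ← zpow_natCast, ← zpow_natCast, ← zpow_mul, ← zpow_add₀ hQ,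
      ← zpow_add₀ hQ]
    congr 1
    push_cast
    linear_combination hc
  rw [← hQe, zpow_sub₀ hw, zpow_natCast, zpow_natCast, mul_pow]
  ring

lemma norm_cexp_pi_I_mul_lt_one {τ : ℂ} (hτ : 0 < τ.im) : ‖cexp (Real.pi * I * τ)‖ < 1 := by
  rw [Complex.norm_exp, Real.exp_lt_one_iff]
  simp only [mul_re, ofReal_re, I_re, mul_zero, ofReal_im, I_im, mul_one, sub_self, zero_mul,
    mul_im, zero_sub, add_zero]
  nlinarith [Real.pi_pos]

lemma jacobiTheta₂_term_eq_zpow (n : ℤ) (z τ : ℂ) :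
    jacobiTheta₂_term n z τ =
      cexp (Real.pi * I * τ) ^ (n ^ 2) * cexp (2 * Real.pi * I * z) ^ n := by
  rw [jacobiTheta₂_term, ← exp_int_mul, ← exp_int_mul, ← exp_add]
  congr 1
  push_cast
  ring

lemma summable_pow_two_mul_add_one_mul {Q : ℂ} (hQ : ‖Q‖ < 1) (w : ℂ) :
    Summable fun k : ℕ => ‖Q ^ (2 * k + 1) * w‖ := by
  simp only [norm_mul, norm_pow, pow_succ, pow_mul]
  refine Summable.mul_right _ (Summable.mul_right _ ?_)
  exact summable_geometric_of_lt_one (by positivity)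
    (pow_lt_one₀ (norm_nonneg _) hQ two_ne_zero)

lemma multipliable_one_add_pow_two_mul_add_one_mul {Q : ℂ} (hQ : ‖Q‖ < 1) (w : ℂ) :
    Multipliable fun k : ℕ => 1 + Q ^ (2 * k + 1) * w :=
  multipliable_one_add_of_summable (summable_pow_two_mul_add_one_mul hQ w)

/-- The Jacobi triple product. -/
theorem jacobiTheta₂_eq_tprod (z : ℂ) {τ : ℂ} (hτ : 0 < τ.im) :
    jacobiTheta₂ z τ = (∏' k : ℕ, (1 - (cexp (Real.pi * I * τ) ^ 2) ^ (k + 1))) *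
      ((∏' k : ℕ, (1 + cexp (Real.pi * I * τ) ^ (2 * k + 1) * cexp (2 * Real.pi * I * z))) *
        ∏' k : ℕ, (1 + cexp (Real.pi * I * τ) ^ (2 * k + 1) *
          (cexp (2 * Real.pi * I * z))⁻¹)) := by
  have hQ : ‖cexp (Real.pi * I * τ)‖ < 1 := norm_cexp_pi_I_mul_lt_one hτ
  have hQ0 : cexp (Real.pi * I * τ) ≠ 0 := exp_ne_zero _
  have hw0 : cexp (2 * Real.pi * I * z) ≠ 0 := exp_ne_zero _
  have hterm := fun n => jacobiTheta₂_term_eq_zpow n z τ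
  have hsum := (summable_jacobiTheta₂_term_iff z τ).mpr hτ
  rw [jacobiTheta₂]
  set Q := cexp (Real.pi * I * τ)
  set w := cexp (2 * Real.pi * I * z)
  have hq : ‖Q ^ 2‖ < 1 := by
    rw [norm_pow]; exact pow_lt_one₀ (norm_nonneg _) hQ two_ne_zero
  have hlim := ((multipliable_one_add_pow_two_mul_add_one_mul hQ w).hasProd.tendsto_prod_nat).mul
    ((multipliable_one_add_pow_two_mul_add_one_mul hQ w⁻¹).hasProd.tendsto_prod_nat)
  obtain ⟨C, hC⟩ := exists_norm_gaussBinom_le hq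
  -- The guard is essential: `toNat` sends n < -N to 0, where the Gaussian binomial is 1. Terms with
  -- n > N vanish by themselves.
  have hfin (N : ℕ) : (∏ k ∈ range N, (1 + Q ^ (2 * k + 1) * w)) *
      ∏ k ∈ range N, (1 + Q ^ (2 * k + 1) * w⁻¹) =
      ∑' n : ℤ, if 0 ≤ n + N then
        gaussBinom (Q ^ 2) (2 * N) (n + N).toNat * jacobiTheta₂_term n z τ else 0 := by
    rw [← prod_mul_distrib, prod_jacobi_finite hQ0 hw0,
      tsum_eq_sum (s := (range (2 * N + 1)).map
        ⟨fun k : ℕ => (k : ℤ) - N, fun a b h => by simpa using h⟩), sum_map]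
    · refine sum_congr rfl fun k _ => ?_
      change _ = if 0 ≤ (k : ℤ) - N + N then gaussBinom (Q ^ 2) (2 * N) ((k : ℤ) - N + N).toNat *
        jacobiTheta₂_term ((k : ℤ) - N) z τ else 0
      simp [hterm]
    · intro n hn
      split_ifs with h
      · rw [gaussBinom_eq_zero_of_lt, zero_mul]
        by_contra! hlt
        refine hn (mem_map.mpr ⟨(n + N).toNat, mem_range.mpr (by omega), ?_⟩)
        change (((n + N).toNat : ℕ) : ℤ) - N = n
        omega
      · rfl
  have hlim' := tendsto_tsum_of_dominated_convergence (𝓕 := atTop)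
    (f := fun (N : ℕ) (n : ℤ) => if 0 ≤ n + N then
        gaussBinom (Q ^ 2) (2 * N) (n + N).toNat * jacobiTheta₂_term n z τ else 0)
    (g := fun n => (∏' k : ℕ, (1 - (Q ^ 2) ^ (k + 1)))⁻¹ * jacobiTheta₂_term n z τ)
    (bound := fun n => C * ‖jacobiTheta₂_term n z τ‖) (hsum.norm.mul_left C)
    (fun n => by
      refine ((tendsto_gaussBinom_central hq n).mul_const _).congr' ?_
      filter_upwards [eventually_ge_atTop n.natAbs] with N hN
      rw [if_pos (by omega)])
    (Eventually.of_forall fun N n => by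
      split_ifs
      · rw [norm_mul]
        gcongr
        exact hC _ _
      · rw [norm_zero]
        exact mul_nonneg ((norm_nonneg _).trans (hC 0 0)) (norm_nonneg _))
  simp_rw [hfin] at hlim
  rw [tendsto_nhds_unique hlim hlim', tsum_mul_left, ← mul_assoc,
    mul_inv_cancel₀ (tprod_one_sub_pow_ne_zero hq), one_mul]

/-! ### Lambda as a quotient of theta constants. -/

lemma one_add_ne_zero_of_norm_lt_one {z : ℂ} (hz : ‖z‖ < 1) : 1 + z ≠ 0 := by
  intro h
  rw [eq_neg_of_add_eq_zero_right h, norm_neg, norm_one] at hz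
  exact lt_irrefl _ hz

lemma summable_norm_pow_succ {Q : ℂ} (hQ : ‖Q‖ < 1) : Summable fun k : ℕ => ‖Q ^ (k + 1)‖ := by
  simp only [norm_pow]
  exact (summable_nat_add_iff 1).mpr (summable_geometric_of_lt_one (norm_nonneg _) hQ)

lemma summable_norm_pow_comp {Q : ℂ} (hQ : ‖Q‖ < 1) {e : ℕ → ℕ} (he : Function.Injective e) :
    Summable fun k : ℕ => ‖Q ^ (e k + 1)‖ :=
  (summable_norm_pow_succ hQ).comp_injective he

lemma multipliable_one_add_pow_comp {Q : ℂ} (hQ : ‖Q‖ < 1) {e : ℕ → ℕ}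
    (he : Function.Injective e) : Multipliable fun k : ℕ => 1 + Q ^ (e k + 1) :=
  multipliable_one_add_of_summable (summable_norm_pow_comp hQ he)

lemma tprod_one_add_pow_comp_ne_zero {Q : ℂ} (hQ : ‖Q‖ < 1) {e : ℕ → ℕ}
    (he : Function.Injective e) : ∏' k : ℕ, (1 + Q ^ (e k + 1)) ≠ 0 :=
  tprod_one_add_ne_zero_of_summable
    (fun _ => one_add_ne_zero_of_norm_lt_one (norm_pow_succ_lt_one hQ _))
    (summable_norm_pow_comp hQ he)

lemma injective_two_mul : Function.Injective fun k : ℕ => 2 * k :=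
  fun a b h => by simpa using h

lemma injective_two_mul_add_one : Function.Injective fun k : ℕ => 2 * k + 1 :=
  fun a b h => by simpa using h

/-- `lam` in terms of the nome `Q = exp (π i τ)`. -/
lemma lam_eq_tprod (τ : ℂ) :
    lam τ = 16 * cexp (Real.pi * I * τ) * ∏' n : ℕ,
      (1 + cexp (Real.pi * I * τ) ^ (2 * n + 1 + 1)) ^ 8 /
        (1 + cexp (Real.pi * I * τ) ^ (2 * n + 1)) ^ 8 := by
  rw [lam]
  congr 2
  · congr 2; ring
  · funext n
    rw [← exp_nat_mul, ← exp_nat_mul]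
    congr 4
    · push_cast; ring
    · push_cast; ring

lemma lam_eq_div {τ : ℂ} (hτ : 0 < τ.im) :
    lam τ = 16 * cexp (Real.pi * I * τ) *
      ((∏' n : ℕ, (1 + cexp (Real.pi * I * τ) ^ (2 * n + 1 + 1))) ^ 8 /
        (∏' n : ℕ, (1 + cexp (Real.pi * I * τ) ^ (2 * n + 1))) ^ 8) := by
  have hQ := norm_cexp_pi_I_mul_lt_one hτ
  have m1 := multipliable_one_add_pow_comp hQ injective_two_mul_add_one
  have m2 := multipliable_one_add_pow_comp hQ injective_two_mul
  have h2 := tprod_one_add_pow_comp_ne_zero hQ injective_two_mul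
  rw [lam_eq_tprod, Multipliable.tprod_div₀ (m1.pow 8) (m2.pow 8), m1.tprod_pow, m2.tprod_pow]
  rw [m2.tprod_pow]
  exact pow_ne_zero _ h2

lemma lam_ne_zero {τ : ℂ} (hτ : 0 < τ.im) : lam τ ≠ 0 := by
  have hQ := norm_cexp_pi_I_mul_lt_one hτ
  rw [lam_eq_div hτ]
  have h1 := tprod_one_add_pow_comp_ne_zero hQ injective_two_mul_add_one
  have h2 := tprod_one_add_pow_comp_ne_zero hQ injective_two_mul
  have h3 := exp_ne_zero (Real.pi * I * τ)
  exact mul_ne_zero (mul_ne_zero (by norm_num) h3) (div_ne_zero (pow_ne_zero _ h1) (pow_ne_zero _ h2))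

lemma jacobiTheta₂_zero_eq_tprod {τ : ℂ} (hτ : 0 < τ.im) :
    jacobiTheta₂ 0 τ = (∏' k : ℕ, (1 - (cexp (Real.pi * I * τ) ^ 2) ^ (k + 1))) *
      (∏' k : ℕ, (1 + cexp (Real.pi * I * τ) ^ (2 * k + 1))) ^ 2 := by
  rw [jacobiTheta₂_eq_tprod 0 hτ]
  simp [sq]

lemma jacobiTheta₂_half_period_eq_tprod {τ : ℂ} (hτ : 0 < τ.im) :
    jacobiTheta₂ (τ / 2) τ = 2 * (∏' k : ℕ, (1 - (cexp (Real.pi * I * τ) ^ 2) ^ (k + 1))) *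
      (∏' k : ℕ, (1 + cexp (Real.pi * I * τ) ^ (2 * k + 1 + 1))) ^ 2 := by
  rw [jacobiTheta₂_eq_tprod _ hτ, show 2 * Real.pi * I * (τ / 2) = Real.pi * I * τ by ring]
  have hQ := norm_cexp_pi_I_mul_lt_one hτ
  have hQ0 : cexp (Real.pi * I * τ) ≠ 0 := exp_ne_zero _
  set Q := cexp (Real.pi * I * τ)
  have m1 := multipliable_one_add_pow_comp hQ injective_two_mul_add_one
  have h1 : ∀ k : ℕ, Q ^ (2 * k + 1) * Q = Q ^ (2 * k + 1 + 1) := fun k => (pow_succ _ _).symm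
  have h2 : ∀ k : ℕ, Q ^ (2 * k + 1) * Q⁻¹ = Q ^ (2 * k) := fun k => by
    rw [pow_succ, mul_assoc, mul_inv_cancel₀ hQ0, mul_one]
  simp_rw [h1, h2]
  -- The factor k = 0 gives the 2 whose fourth power becomes the 16 in λ; the remaining factors
  -- repeat the first product.
  rw [tprod_eq_zero_mul' (f := fun k => 1 + Q ^ (2 * k)) (by simpa [mul_add] using m1)]
  simp only [mul_zero, pow_zero, mul_add, mul_one]
  ring

lemma jacobiTheta₂_zero_ne_zero {τ : ℂ} (hτ : 0 < τ.im) : jacobiTheta₂ 0 τ ≠ 0 := by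
  have hQ := norm_cexp_pi_I_mul_lt_one hτ
  rw [jacobiTheta₂_zero_eq_tprod hτ]
  refine mul_ne_zero (tprod_one_sub_pow_ne_zero ?_)
    (pow_ne_zero _ (tprod_one_add_pow_comp_ne_zero hQ injective_two_mul))
  rw [norm_pow]
  exact pow_lt_one₀ (norm_nonneg _) hQ two_ne_zero

theorem lam_eq_jacobiTheta₂ {τ : ℂ} (hτ : 0 < τ.im) :
    lam τ = cexp (Real.pi * I * τ) * jacobiTheta₂ (τ / 2) τ ^ 4 / jacobiTheta₂ 0 τ ^ 4 := by
  have h0 := jacobiTheta₂_zero_ne_zero hτ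
  have h0' := h0
  rw [jacobiTheta₂_zero_eq_tprod hτ] at h0'
  rw [eq_div_iff (pow_ne_zero _ h0), jacobiTheta₂_zero_eq_tprod hτ,
    jacobiTheta₂_half_period_eq_tprod hτ, lam_eq_div hτ]
  have hB := (pow_ne_zero_iff two_ne_zero).mp (right_ne_zero_of_mul h0')
  field_simp
  ring

/-! ### Jacobi's quartic identity. -/

/-- Pairs of integers, split by the parity of their sum. -/
def parityEquiv : (ℤ × ℤ) ⊕ (ℤ × ℤ) ≃ ℤ × ℤ where
  toFun := Sum.elim (fun p => (p.1 + p.2, p.1 - p.2)) (fun p => (p.1 + p.2 + 1, p.1 - p.2))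
  invFun p := if (p.1 + p.2) % 2 = 0 then Sum.inl ((p.1 + p.2) / 2, (p.1 - p.2) / 2)
    -- Floor division discards the odd remainder 1 in both coordinates.
    else Sum.inr ((p.1 + p.2) / 2, (p.1 - p.2) / 2)
  left_inv := by
    rintro (⟨a, b⟩ | ⟨a, b⟩)
    · change (if (a + b + (a - b)) % 2 = 0 then
        Sum.inl ((a + b + (a - b)) / 2, (a + b - (a - b)) / 2) else _) = _
      rw [if_pos (by omega)]
      congr 2 <;> omega
    · change (if (a + b + 1 + (a - b)) % 2 = 0 then _ else
        Sum.inr ((a + b + 1 + (a - b)) / 2, (a + b + 1 - (a - b)) / 2)) = _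
      rw [if_neg (by omega)]
      congr 2 <;> omega
  right_inv := by
    rintro ⟨a, b⟩
    dsimp only
    split_ifs with h
    · simp only [Sum.elim_inl, Prod.mk.injEq]
      constructor <;> omega
    · simp only [Sum.elim_inr, Prod.mk.injEq]
      constructor <;> omega

lemma summable_norm_jacobiTheta₂_term (z : ℂ) {τ : ℂ} (hτ : 0 < τ.im) :
    Summable fun n => ‖jacobiTheta₂_term n z τ‖ :=
  ((summable_jacobiTheta₂_term_iff z τ).mpr hτ).norm

lemma hasSum_jacobiTheta₂_mul (z w : ℂ) {τ : ℂ} (hτ : 0 < τ.im) :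
    HasSum (fun p : ℤ × ℤ => jacobiTheta₂_term p.1 z τ * jacobiTheta₂_term p.2 w τ)
      (jacobiTheta₂ z τ * jacobiTheta₂ w τ) := by
  have hz := summable_norm_jacobiTheta₂_term z hτ
  have hw := summable_norm_jacobiTheta₂_term w hτ
  rw [jacobiTheta₂, jacobiTheta₂, tsum_mul_tsum_of_summable_norm hz hw]
  exact (summable_mul_of_summable_norm hz hw).hasSum

/-- The addition formula for the product of two theta functions of the same modulus. -/
theorem jacobiTheta₂_mul_jacobiTheta₂ (z w : ℂ) {τ : ℂ} (hτ : 0 < τ.im) :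
    jacobiTheta₂ z τ * jacobiTheta₂ w τ =
      jacobiTheta₂ (z + w) (2 * τ) * jacobiTheta₂ (z - w) (2 * τ) +
        cexp (Real.pi * I * (τ + 2 * z)) *
          (jacobiTheta₂ (z + w + τ) (2 * τ) * jacobiTheta₂ (z - w + τ) (2 * τ)) := by
  have hτ2 : 0 < (2 * τ).im := by simpa using hτ
  refine HasSum.unique (hasSum_jacobiTheta₂_mul z w hτ) (parityEquiv.hasSum_iff.mp ?_)
  refine HasSum.sum ?_ ?_
  · refine Eq.subst (motive := fun f => HasSum f _) (funext fun p => ?_)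
      (hasSum_jacobiTheta₂_mul (z + w) (z - w) hτ2)
    simp only [parityEquiv, Function.comp_apply, Equiv.coe_fn_mk, Sum.elim_inl,
      jacobiTheta₂_term, ← exp_add]
    congr 1
    push_cast
    ring
  · refine Eq.subst (motive := fun f => HasSum f _) (funext fun p => ?_)
      ((hasSum_jacobiTheta₂_mul (z + w + τ) (z - w + τ) hτ2).mul_left
        (cexp (Real.pi * I * (τ + 2 * z))))
    simp only [parityEquiv, Function.comp_apply, Equiv.coe_fn_mk, Sum.elim_inr,
      jacobiTheta₂_term, ← exp_add]
    congr 1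
    push_cast
    ring

/-- Jacobi's identity `θ₃⁴ = θ₂⁴ + θ₄⁴`. -/
theorem jacobiTheta₂_fourth_powers {τ : ℂ} (hτ : 0 < τ.im) :
    jacobiTheta₂ 0 τ ^ 4 =
      cexp (Real.pi * I * τ) * jacobiTheta₂ (τ / 2) τ ^ 4 + jacobiTheta₂ (1 / 2) τ ^ 4 := by
  have h3 := jacobiTheta₂_mul_jacobiTheta₂ 0 0 hτ
  have h4 := jacobiTheta₂_mul_jacobiTheta₂ (1 / 2) (1 / 2) hτ
  have h2 := jacobiTheta₂_mul_jacobiTheta₂ (τ / 2) (τ / 2) hτ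
  have e1 : jacobiTheta₂ 1 (2 * τ) = jacobiTheta₂ 0 (2 * τ) := by
    simpa using jacobiTheta₂_add_left 0 (2 * τ)
  have e2 : jacobiTheta₂ (1 + τ) (2 * τ) = jacobiTheta₂ τ (2 * τ) := by
    rw [add_comm]; exact jacobiTheta₂_add_left τ (2 * τ)
  have e3 : jacobiTheta₂ (τ + τ) (2 * τ) =
      cexp (-Real.pi * I * (2 * τ)) * jacobiTheta₂ 0 (2 * τ) := by
    have := jacobiTheta₂_add_left' 0 (2 * τ)
    simpa [← two_mul] using this
  have e4 : cexp (Real.pi * I * (τ + 2 * (1 / 2))) = -cexp (Real.pi * I * τ) := by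
    rw [show Real.pi * I * (τ + 2 * (1 / 2)) = Real.pi * I * τ + Real.pi * I by ring, exp_add,
      exp_pi_mul_I]
    ring
  have e5 : cexp (Real.pi * I * (τ + 2 * (τ / 2))) * cexp (-Real.pi * I * (2 * τ)) = 1 := by
    rw [← exp_add, ← exp_zero]
    congr 1
    ring
  simp only [add_zero, sub_zero, zero_add, mul_zero] at h3
  simp only [add_halves, sub_self, zero_add, e1, e2, e4] at h4
  simp only [add_halves, sub_self, zero_add, e3] at h2
  set E := cexp (Real.pi * I * τ)
  set A := jacobiTheta₂ 0 (2 * τ)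
  set B := jacobiTheta₂ τ (2 * τ)
  have h2' : jacobiTheta₂ (τ / 2) τ * jacobiTheta₂ (τ / 2) τ = 2 * (A * B) := by
    rw [h2]
    linear_combination A * B * e5
  -- The three squares are A² + EB², A² - EB² and 2AB, so the claim is (A² + EB²)² - (A² - EB²)² =
  -- E(2AB)².
  have p (x : ℂ) : x ^ 4 = (x * x) ^ 2 := by ring
  rw [p, p, p (jacobiTheta₂ (1 / 2) τ), h3, h4, h2']
  ring

/-! ### Transformations of lambda under inversion, translation and conjugation. -/

lemma one_sub_lam {τ : ℂ} (hτ : 0 < τ.im) :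
    1 - lam τ = jacobiTheta₂ (1 / 2) τ ^ 4 / jacobiTheta₂ 0 τ ^ 4 := by
  have h0 := pow_ne_zero 4 (jacobiTheta₂_zero_ne_zero hτ)
  rw [lam_eq_jacobiTheta₂ hτ, eq_div_iff h0, sub_mul, div_mul_cancel₀ _ h0, one_mul,
    jacobiTheta₂_fourth_powers hτ]
  ring

lemma neg_one_div_im_pos {τ : ℂ} (hτ : 0 < τ.im) : 0 < (-1 / τ).im := by
  have h : 0 < normSq τ := normSq_pos.mpr fun h => by simp [h] at hτ
  rw [neg_div, one_div, neg_im, inv_im, neg_div, neg_neg]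
  positivity

/-- Inversion exchanges θ₂ and θ₄ up to the factor shared with θ₃, which cancels in the quotient. -/
theorem lam_neg_one_div {τ : ℂ} (hτ : 0 < τ.im) : lam (-1 / τ) = 1 - lam τ := by
  have hτ0 : τ ≠ 0 := fun h => by simp [h] at hτ
  have hS := neg_one_div_im_pos hτ
  have h1 := jacobiTheta₂_functional_equation (1 / 2) τ
  have h0 := jacobiTheta₂_functional_equation 0 τ
  have n0 := jacobiTheta₂_zero_ne_zero hτ
  have n0' := jacobiTheta₂_zero_ne_zero hS
  rw [one_sub_lam hτ, lam_eq_jacobiTheta₂ hS]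
  rw [show (1 / 2 : ℂ) / τ = -(-1 / τ / 2) by ring, jacobiTheta₂_neg_left] at h1
  simp only [zero_div, ne_eq, OfNat.ofNat_ne_zero, not_false_eq_true, zero_pow, mul_zero,
    exp_zero, mul_one] at h0
  set c := 1 / (-I * τ) ^ (1 / 2 : ℂ)
  have hE : cexp (-Real.pi * I * (1 / 2) ^ 2 / τ) ^ 4 = cexp (Real.pi * I * (-1 / τ)) := by
    rw [← exp_nat_mul]
    congr 1
    push_cast
    ring
  have hc : c ≠ 0 := by
    rintro hc
    rw [hc, zero_mul] at h0
    exact n0 h0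
  rw [h1, h0, mul_pow, mul_pow, hE, mul_pow]
  field_simp

lemma one_sub_lam_ne_zero {τ : ℂ} (hτ : 0 < τ.im) : 1 - lam τ ≠ 0 := by
  rw [← lam_neg_one_div hτ]
  exact lam_ne_zero (neg_one_div_im_pos hτ)

/-- Since n² and n have the same parity, exp(πin²) = exp(πin). -/
lemma jacobiTheta₂_add_one (z τ : ℂ) : jacobiTheta₂ z (τ + 1) = jacobiTheta₂ (z + 1 / 2) τ := by
  refine tsum_congr fun n => ?_
  obtain ⟨m, hm⟩ := (Int.even_mul_succ_self (n - 1)).two_dvd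
  have hm' : (n : ℂ) ^ 2 - n = 2 * m := by
    have : n ^ 2 - n = 2 * m := by rw [← hm]; ring
    exact_mod_cast this
  rw [jacobiTheta₂_term, jacobiTheta₂_term, exp_eq_exp_iff_exists_int]
  exact ⟨m, by linear_combination Real.pi * I * hm'⟩

/-- Translation exchanges θ₃ and θ₄ and changes the sign of the nome. -/
theorem lam_add_one {τ : ℂ} (hτ : 0 < τ.im) : lam (τ + 1) = lam τ / (lam τ - 1) := by
  have hT : 0 < (τ + 1).im := by simpa using hτ
  have n0 := jacobiTheta₂_zero_ne_zero hτ
  have n1 := one_sub_lam_ne_zero hτ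
  rw [← neg_sub 1 (lam τ), one_sub_lam hτ, lam_eq_jacobiTheta₂ hτ, lam_eq_jacobiTheta₂ hT,
    jacobiTheta₂_add_one, jacobiTheta₂_add_one, zero_add,
    show (τ + 1) / 2 + 1 / 2 = τ / 2 + 1 by ring, jacobiTheta₂_add_left, mul_add, exp_add,
    mul_one, exp_pi_mul_I]
  have n2 : jacobiTheta₂ (1 / 2) τ ≠ 0 := by
    intro h
    rw [one_sub_lam hτ, h] at n1
    simp at n1
  field_simp

lemma lam_sub_one {τ : ℂ} (hτ : 0 < τ.im) : lam (τ - 1) = lam τ / (lam τ - 1) := by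
  have hT : 0 < (τ - 1).im := by simpa using hτ
  have h := lam_add_one hT
  have n1 := one_sub_lam_ne_zero hT
  have n1' : lam (τ - 1) - 1 ≠ 0 := by rw [← neg_sub]; exact neg_ne_zero.mpr n1
  rw [sub_add_cancel] at h
  have e : lam τ - 1 = 1 / (lam (τ - 1) - 1) := by rw [h]; field_simp; ring
  rw [e, h]
  field_simp

lemma lam_neg_conj {τ : ℂ} (hτ : 0 < τ.im) :
    lam (-(starRingEnd ℂ) τ) = (starRingEnd ℂ) (lam τ) := by
  have hτ' : 0 < (-(starRingEnd ℂ) τ).im := by simpa using hτ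
  have h : cexp (Real.pi * I * -(starRingEnd ℂ) τ) = (starRingEnd ℂ) (cexp (Real.pi * I * τ)) := by
    rw [← exp_conj]
    simp
  rw [lam_eq_jacobiTheta₂ hτ, lam_eq_jacobiTheta₂ hτ', h, neg_div, jacobiTheta₂_neg_left]
  simp [jacobiTheta₂_conj, map_ofNat]

/-! ### Argument and modulus of lambda for small imaginary nomes. -/

lemma hasSum_pow_odd {p : ℝ} (h0 : 0 ≤ p) (h1 : p < 1) :
    HasSum (fun n : ℕ => p ^ (2 * n + 1)) (p / (1 - p ^ 2)) := by
  have h := (hasSum_geometric_of_lt_one (sq_nonneg p)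
    (pow_lt_one₀ h0 h1 two_ne_zero)).mul_right p
  simpa only [pow_succ _ (2 * _), pow_mul, inv_mul_eq_div] using h

lemma hasSum_pow_even {p : ℝ} (h0 : 0 ≤ p) (h1 : p < 1) :
    HasSum (fun n : ℕ => p ^ (2 * n + 1 + 1)) (p ^ 2 / (1 - p ^ 2)) := by
  have h := (hasSum_pow_odd h0 h1).mul_right p
  rwa [show p / (1 - p ^ 2) * p = p ^ 2 / (1 - p ^ 2) by ring] at h

lemma sum_pow_odd_even {p : ℝ} (h0 : 0 ≤ p) (h1 : p < 1) :
    p ^ 2 / (1 - p ^ 2) + p / (1 - p ^ 2) = p / (1 - p) := by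
  have h2 : 1 - p ≠ 0 := by linarith
  have h3 : 1 - p ^ 2 ≠ 0 := by nlinarith
  field_simp
  ring

/-- A sum of principal logarithms, each bounded by |log(1 + z)| ≤ (3/2)|z| for |z| ≤ 1/2; it
controls the argument of the product. -/
lemma exists_cexp_eq_tprod {Q : ℂ} (hQ : ‖Q‖ ≤ 1 / 2) {e : ℕ → ℕ} (he : Function.Injective e)
    {s : ℝ} (hs : HasSum (fun n => ‖Q‖ ^ (e n + 1)) s) :
    ∃ S : ℂ, cexp S = ∏' n, (1 + Q ^ (e n + 1)) ∧ ‖S‖ ≤ 3 / 2 * s := by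
  have hQ1 : ‖Q‖ < 1 := by linarith
  have hsum : Summable fun n => Q ^ (e n + 1) := (summable_norm_pow_comp hQ1 he).of_norm
  refine ⟨∑' n, log (1 + Q ^ (e n + 1)), cexp_tsum_eq_tprod
    (fun n => one_add_ne_zero_of_norm_lt_one (norm_pow_succ_lt_one hQ1 _))
    (summable_log_one_add_of_summable hsum), ?_⟩
  refine tsum_of_norm_bounded (hs.mul_left (3 / 2)) fun n => ?_
  rw [← norm_pow]
  refine norm_log_one_add_half_le_self ?_
  rw [norm_pow]
  exact (pow_le_of_le_one (norm_nonneg _) hQ1.le (Nat.succ_ne_zero _)).trans hQ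

/-- If the nome of `τ` is `i p` with `0 < p` small, then `lam τ` lies in the upper half plane. -/
lemma lam_im_pos {τ : ℂ} (hτ : 0 < τ.im) {p : ℝ} (hp0 : 0 < p) (hp : p ≤ 1 / 14)
    (hQ : cexp (Real.pi * I * τ) = I * p) : 0 < (lam τ).im := by
  rw [lam_eq_div hτ, hQ]
  have hn : ‖I * (p : ℂ)‖ = p := by simp [abs_of_pos hp0]
  have hQ2 : ‖I * (p : ℂ)‖ ≤ 1 / 2 := by rw [hn]; linarith
  have h1 : p < 1 := by linarith
  obtain ⟨S, hS, hS'⟩ := exists_cexp_eq_tprod hQ2 injective_two_mul_add_one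
    (by rw [hn]; exact hasSum_pow_even hp0.le h1)
  obtain ⟨T, hT, hT'⟩ := exists_cexp_eq_tprod hQ2 injective_two_mul
    (by rw [hn]; exact hasSum_pow_odd hp0.le h1)
  rw [← hS, ← hT, ← exp_nat_mul, ← exp_nat_mul, ← exp_sub, ← mul_sub]
  -- With p ≤ 1/14 the bound is 8 · (3/2) · (1/13) = 12/13, so the argument of exp W stays below
  -- π/2.
  have hb : ‖((8 : ℕ) : ℂ) * (S - T)‖ < 1 := by
    have hpp : p / (1 - p) ≤ 1 / 13 := by
      rw [div_le_div_iff₀ (by linarith) (by norm_num)]; linarith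
    have := sum_pow_odd_even hp0.le h1
    calc ‖((8 : ℕ) : ℂ) * (S - T)‖ = 8 * ‖S - T‖ := by simp
      _ ≤ 8 * (‖S‖ + ‖T‖) := by gcongr; exact norm_sub_le _ _
      _ < 1 := by linarith
  set W := ((8 : ℕ) : ℂ) * (S - T)
  have hW : |W.im| < 1 := (abs_im_le_norm W).trans_lt hb
  have hcos : 0 < Real.cos W.im := by
    refine Real.cos_pos_of_mem_Ioo ⟨?_, ?_⟩ <;>
      linarith [Real.pi_gt_three, abs_lt.mp hW]
  have : 16 * (I * (p : ℂ)) * cexp W = ((16 * p : ℝ) : ℂ) * (I * cexp W) := by push_cast; ring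
  rw [this, im_ofReal_mul, I_mul_im, exp_re]
  positivity

lemma norm_tprod_le_of_norm_le_mul_exp {f g : ℕ → ℂ} (hf : Multipliable f) (hg : Multipliable g)
    {e : ℕ → ℝ} {s : ℝ} (he : HasSum e s) (h : ∀ n, ‖f n‖ ≤ ‖g n‖ * Real.exp (e n)) :
    ‖∏' n, f n‖ ≤ ‖∏' n, g n‖ * Real.exp s := by
  have h1 := hf.hasProd.tendsto_prod_nat.norm
  have h2 := hg.hasProd.tendsto_prod_nat.norm.mul
    ((Real.continuous_exp.tendsto s).comp he.tendsto_sum_nat)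
  refine le_of_tendsto_of_tendsto' h1 h2 fun N => ?_
  simp only [Function.comp_apply, Real.exp_sum, norm_prod, ← prod_mul_distrib]
  exact prod_le_prod (fun _ _ => norm_nonneg _) fun n _ => h n

/-- Combines |1 + w| ≥ 1 - p with 1 + t ≤ exp t, giving factorwise errors that add up in an infinite
product. -/
lemma norm_one_add_le_mul_exp {z w : ℂ} {p : ℝ} (hp : p < 1) (hw : ‖w‖ ≤ p) :
    ‖1 + z‖ ≤ ‖1 + w‖ * Real.exp (‖z - w‖ / (1 - p)) := by
  have h1 : 1 - p ≤ ‖1 + w‖ := by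
    have := norm_sub_norm_le (1 : ℂ) (-w)
    rw [norm_one, norm_neg, sub_neg_eq_add] at this
    linarith
  have h2 : 0 < 1 - p := by linarith
  calc ‖1 + z‖ = ‖(1 + w) + (z - w)‖ := by ring_nf
    _ ≤ ‖1 + w‖ + ‖z - w‖ := norm_add_le _ _
    _ ≤ ‖1 + w‖ + ‖1 + w‖ * (‖z - w‖ / (1 - p)) := by
        gcongr
        calc ‖z - w‖ = (1 - p) * (‖z - w‖ / (1 - p)) := by field_simp
          _ ≤ _ := by gcongr
    _ = ‖1 + w‖ * (‖z - w‖ / (1 - p) + 1) := by ring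
    _ ≤ _ := by gcongr; exact Real.add_one_le_exp _

lemma norm_I_mul_pow_sub {p r : ℝ} (hp : 0 ≤ p) (hpr : p ≤ r) (k : ℕ) :
    ‖(I * (r : ℂ)) ^ k - (I * (p : ℂ)) ^ k‖ = r ^ k - p ^ k := by
  rw [mul_pow, mul_pow, ← mul_sub, norm_mul, norm_pow, norm_I, one_pow, one_mul, ← ofReal_pow,
    ← ofReal_pow, ← ofReal_sub, norm_real, Real.norm_of_nonneg]
  exact sub_nonneg.mpr (pow_le_pow_left₀ hp hpr k)

/-- `‖lam τ‖` increases with `p` for small nomes `i p`. -/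
lemma norm_lam_mono {τ σ : ℂ} (hτ : 0 < τ.im) (hσ : 0 < σ.im) {p r : ℝ} (hp0 : 0 < p)
    (hpr : p ≤ r) (hr : r ≤ 1 / 14) (hp : cexp (Real.pi * I * τ) = I * p)
    (hr' : cexp (Real.pi * I * σ) = I * r) : ‖lam τ‖ ≤ ‖lam σ‖ := by
  rw [lam_eq_div hτ, lam_eq_div hσ, hp, hr']
  have hr0 : 0 < r := hp0.trans_le hpr
  have hr1 : r < 1 := by linarith
  have hp1 : p < 1 := by linarith
  have np : ‖I * (p : ℂ)‖ = p := by simp [abs_of_pos hp0]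
  have nr : ‖I * (r : ℂ)‖ = r := by simp [abs_of_pos hr0]
  have lp : ‖I * (p : ℂ)‖ < 1 := by rwa [np]
  have lr : ‖I * (r : ℂ)‖ < 1 := by rwa [nr]
  have bp (k : ℕ) : ‖(I * (p : ℂ)) ^ (k + 1)‖ ≤ r := by
    rw [norm_pow, np]
    exact (pow_le_of_le_one hp0.le hp1.le (Nat.succ_ne_zero _)).trans hpr
  have br (k : ℕ) : ‖(I * (r : ℂ)) ^ (k + 1)‖ ≤ r := by
    rw [norm_pow, nr]
    exact pow_le_of_le_one hr0.le hr1.le (Nat.succ_ne_zero _)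
  have hA := norm_tprod_le_of_norm_le_mul_exp
    (multipliable_one_add_pow_comp lp injective_two_mul_add_one)
    (multipliable_one_add_pow_comp lr injective_two_mul_add_one)
    (((hasSum_pow_even hr0.le hr1).sub (hasSum_pow_even hp0.le hp1)).div_const (1 - r))
    fun n => by
      rw [← norm_I_mul_pow_sub hp0.le hpr, norm_sub_rev]
      exact norm_one_add_le_mul_exp hr1 (br _)
  have hB := norm_tprod_le_of_norm_le_mul_exp
    (multipliable_one_add_pow_comp lr injective_two_mul)
    (multipliable_one_add_pow_comp lp injective_two_mul)
    (((hasSum_pow_odd hr0.le hr1).sub (hasSum_pow_odd hp0.le hp1)).div_const (1 - r))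
    fun n => by
      rw [← norm_I_mul_pow_sub hp0.le hpr]
      exact norm_one_add_le_mul_exp hr1 (bp _)
  have hBp : 0 < ‖∏' n : ℕ, (1 + (I * (p : ℂ)) ^ (2 * n + 1))‖ :=
    norm_pos_iff.mpr (tprod_one_add_pow_comp_ne_zero lp injective_two_mul)
  have hBr : 0 < ‖∏' n : ℕ, (1 + (I * (r : ℂ)) ^ (2 * n + 1))‖ :=
    norm_pos_iff.mpr (tprod_one_add_pow_comp_ne_zero lr injective_two_mul)
  simp only [norm_mul, norm_div, norm_pow, norm_I, norm_real, one_mul, Real.norm_of_nonneg hp0.le,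
    Real.norm_of_nonneg hr0.le]
  set A₁ := ‖∏' n : ℕ, (1 + (I * (p : ℂ)) ^ (2 * n + 1 + 1))‖
  set A₂ := ‖∏' n : ℕ, (1 + (I * (r : ℂ)) ^ (2 * n + 1 + 1))‖
  set B₁ := ‖∏' n : ℕ, (1 + (I * (p : ℂ)) ^ (2 * n + 1))‖
  set B₂ := ‖∏' n : ℕ, (1 + (I * (r : ℂ)) ^ (2 * n + 1))‖
  set u := (r ^ 2 / (1 - r ^ 2) - p ^ 2 / (1 - p ^ 2)) / (1 - r)
  set v := (r / (1 - r ^ 2) - p / (1 - p ^ 2)) / (1 - r)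
  have huv : u + v = (r - p) / ((1 - p) * (1 - r) ^ 2) := by
    have h1 : u + v = ((r ^ 2 / (1 - r ^ 2) + r / (1 - r ^ 2)) -
      (p ^ 2 / (1 - p ^ 2) + p / (1 - p ^ 2))) / (1 - r) := by simp only [u, v]; ring
    rw [h1, sum_pow_odd_even hr0.le hr1, sum_pow_odd_even hp0.le hp1]
    have h2 : 1 - p ≠ 0 := by linarith
    have h3 : 1 - r ≠ 0 := by linarith
    field_simp
    ring
  -- The growth of the prefactor p outweighs the change of the products: 8r ≤ 8/14 < (13/14)³ ≤ (1 -
  -- p)(1 - r)², so 8(u + v) ≤ 1 - p/r ≤ log(r/p).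
  have hexp : Real.exp (8 * (u + v)) ≤ r / p := by
    have hd : (13 / 14 : ℝ) ^ 3 ≤ (1 - p) * (1 - r) ^ 2 := by
      calc (13 / 14 : ℝ) ^ 3 = 13 / 14 * (13 / 14) ^ 2 := by ring
        _ ≤ _ := by gcongr <;> linarith
    have h1 : 8 * (u + v) ≤ 1 - (r / p)⁻¹ := by
      rw [huv, inv_div, one_sub_div hr0.ne', ← mul_div_assoc,
        div_le_div_iff₀ (lt_of_lt_of_le (by norm_num) hd) hr0]
      nlinarith [mul_le_mul_of_nonneg_left hd (sub_nonneg.mpr hpr),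
        mul_le_mul_of_nonneg_left hr (sub_nonneg.mpr hpr)]
    have h2 := h1.trans (Real.one_sub_inv_le_log_of_pos (div_pos hr0 hp0))
    exact (Real.le_log_iff_exp_le (div_pos hr0 hp0)).mp h2
  have hmul : A₁ * B₂ ≤ A₂ * B₁ * Real.exp (u + v) := by
    calc A₁ * B₂ ≤ (A₂ * Real.exp u) * (B₁ * Real.exp v) := by gcongr
      _ = _ := by rw [Real.exp_add]; ring
  have hpow : p * (A₁ * B₂) ^ 8 ≤ r * (A₂ * B₁) ^ 8 := by
    calc p * (A₁ * B₂) ^ 8 ≤ p * (A₂ * B₁ * Real.exp (u + v)) ^ 8 := by gcongr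
      _ = p * (A₂ * B₁) ^ 8 * Real.exp (8 * (u + v)) := by
          rw [mul_pow, ← Real.exp_nat_mul]; push_cast; ring
      _ ≤ p * (A₂ * B₁) ^ 8 * (r / p) := by gcongr
      _ = _ := by field_simp
  rw [mul_assoc, mul_assoc ‖(16 : ℂ)‖]
  gcongr ‖(16 : ℂ)‖ * ?_
  rw [← mul_div_assoc, ← mul_div_assoc, div_le_div_iff₀ (by positivity) (by positivity)]
  calc p * A₁ ^ 8 * B₂ ^ 8 = p * (A₁ * B₂) ^ 8 := by ring
    _ ≤ r * (A₂ * B₁) ^ 8 := hpow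
    _ = _ := by ring

/-! ### Principal roots and the collapse of the radicals. -/

lemma sqrtC_sq {y : ℝ} (hy : 0 ≤ y) : sqrtC ((y : ℂ) ^ 2) = y := by
  rw [sqrtC, one_div]
  refine pow_cpow_ofNat_inv ?_ ?_ <;> rw [arg_ofReal_of_nonneg hy]
  · simpa using Real.pi_pos
  · positivity

lemma cbrtC_cube {y : ℝ} (hy : 0 ≤ y) : cbrtC ((y : ℂ) ^ 3) = y := by
  rw [cbrtC, one_div]
  refine pow_cpow_ofNat_inv ?_ ?_ <;> rw [arg_ofReal_of_nonneg hy]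
  · simpa using Real.pi_pos
  · positivity

lemma sqrtC_eq_of_sq_eq {y : ℝ} (hy : 0 ≤ y) {z : ℂ} (h : z = ((y ^ 2 : ℝ) : ℂ)) :
    sqrtC z = y := by
  rw [h, ofReal_pow, sqrtC_sq hy]

lemma cbrtC_eq_of_cube_eq {y : ℝ} (hy : 0 ≤ y) {z : ℂ} (h : z = ((y ^ 3 : ℝ) : ℂ)) :
    cbrtC z = y := by
  rw [h, ofReal_pow, cbrtC_cube hy]

section Radicals

variable {d x : ℝ}

/-- The invariant `j` of the lambda value `1 / (1 / 2 - i x)`. -/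
def jOfCoord (x : ℝ) : ℝ := -(64 * (4 * x ^ 2 - 3) ^ 3 / (1 + 4 * x ^ 2) ^ 2)

lemma one_add_four_mul_sq_pos (x : ℝ) : 0 < 1 + 4 * x ^ 2 := by positivity

lemma four_mul_sq_sub_three_nonneg (hx : √3 / 2 ≤ x) : 0 ≤ 4 * x ^ 2 - 3 := by
  have h : √3 ^ 2 = 3 := Real.sq_sqrt (by norm_num)
  nlinarith [Real.sqrt_nonneg 3]

lemma nonneg_of_sqrt_three_le (hx : √3 / 2 ≤ x) : 0 ≤ x :=
  le_trans (by positivity) hx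

lemma jd_eq_jOfCoord (h : lam ((1 + sqrtNeg d) / 2) = 1 / (1 / 2 - I * x)) :
    jd d = (jOfCoord x : ℂ) := by
  have h2 : (1 + 4 * x ^ 2 : ℂ) ≠ 0 := by
    exact_mod_cast (one_add_four_mul_sq_pos x).ne'
  have hI := I_sq
  have hf : (1 + 4 * x ^ 2 : ℂ) = (1 - 2 * I * x) * (1 + 2 * I * x) := by
    linear_combination (4 * x ^ 2 : ℂ) * hI
  rw [hf] at h2
  have h3 := left_ne_zero_of_mul h2
  have h4 := right_ne_zero_of_mul h2
  have hL : lam ((1 + sqrtNeg d) / 2) = 2 / (1 - 2 * I * x) := by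
    rw [h, show (1 / 2 - I * x : ℂ) = (1 - 2 * I * x) / 2 by ring, one_div_div]
  have e1 : 1 - 2 / (1 - 2 * I * (x : ℂ)) = -(1 + 2 * I * x) / (1 - 2 * I * x) := by
    field_simp
    ring
  have e2 : 1 - 2 / (1 - 2 * I * (x : ℂ)) + (2 / (1 - 2 * I * (x : ℂ))) ^ 2 =
      (3 - 4 * x ^ 2) / (1 - 2 * I * x) ^ 2 := by
    field_simp
    linear_combination (4 * x ^ 2 : ℂ) * hI
  rw [jd, j, hL, e2, e1, jOfCoord]
  push_cast
  rw [hf]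
  field_simp
  ring

lemma sqrtC_const_sub_jd (hx : √3 / 2 ≤ x) (hj : jd d = (jOfCoord x : ℂ)) :
    sqrtC (1728 - jd d) = ((16 * x * (4 * x ^ 2 + 9) / (1 + 4 * x ^ 2) : ℝ) : ℂ) := by
  have h0 := nonneg_of_sqrt_three_le hx
  refine sqrtC_eq_of_sq_eq (by positivity) ?_
  rw [hj, show (1728 - (jOfCoord x : ℂ)) = ((1728 - jOfCoord x : ℝ) : ℂ) by push_cast; rfl]
  congr 1
  rw [jOfCoord]
  have := (one_add_four_mul_sq_pos x).ne'
  field_simp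
  ring

/-- The radicand is j²(1728 - j) with j ≤ 0, so the root is -j √(1728 - j). -/
lemma betad_eq (hx : √3 / 2 ≤ x) (hj : jd d = (jOfCoord x : ℂ)) :
    betad d = ((1024 * x * (4 * x ^ 2 + 9) * (4 * x ^ 2 - 3) ^ 3 / (1 + 4 * x ^ 2) ^ 3 : ℝ) : ℂ) := by
  have h0 := nonneg_of_sqrt_three_le hx
  have h3 := four_mul_sq_sub_three_nonneg hx
  refine sqrtC_eq_of_sq_eq (by positivity) ?_
  rw [hj, show (1728 * (jOfCoord x : ℂ) ^ 2 - (jOfCoord x : ℂ) ^ 3) =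
    ((1728 * jOfCoord x ^ 2 - jOfCoord x ^ 3 : ℝ) : ℂ) by push_cast; rfl]
  congr 1
  rw [jOfCoord]
  have := (one_add_four_mul_sq_pos x).ne'
  field_simp
  ring

/-- Rests on 4(x ± √3/2)³ = x(4x² + 9) ± (3√3/2)(4x² + 1), here with the plus sign. -/
lemma cbrtC_betad_sub (hx : √3 / 2 ≤ x) (hj : jd d = (jOfCoord x : ℂ)) :
    cbrtC (betad d - 24 * (√3 : ℝ) * jd d) =
      ((4 * (4 * x ^ 2 - 3) * (4 * x + 2 * √3) / (1 + 4 * x ^ 2) : ℝ) : ℂ) := by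
  have h0 := nonneg_of_sqrt_three_le hx
  have h3 := four_mul_sq_sub_three_nonneg hx
  refine cbrtC_eq_of_cube_eq (by positivity) ?_
  rw [betad_eq hx hj, hj]
  norm_cast
  rw [jOfCoord]
  have hs : √3 ^ 2 = 3 := Real.sq_sqrt (by norm_num)
  have := (one_add_four_mul_sq_pos x).ne'
  generalize √3 = s at hs
  field_simp
  linear_combination (-(16 * (4 * x ^ 2 - 3) ^ 3 * (24 * x + 4 * s)) * 8 : ℝ) * hs

lemma cbrtC_betad_add (hx : √3 / 2 ≤ x) (hj : jd d = (jOfCoord x : ℂ)) :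
    cbrtC (betad d + 24 * (√3 : ℝ) * jd d) =
      ((4 * (4 * x ^ 2 - 3) * (4 * x - 2 * √3) / (1 + 4 * x ^ 2) : ℝ) : ℂ) := by
  have h3 := four_mul_sq_sub_three_nonneg hx
  -- The bound x ≥ √3/2 is exactly what makes this cube root real and nonnegative.
  have h4 : 0 ≤ 4 * x - 2 * √3 := by linarith
  refine cbrtC_eq_of_cube_eq (by positivity) ?_
  rw [betad_eq hx hj, hj]
  norm_cast
  rw [jOfCoord]
  have hs : √3 ^ 2 = 3 := Real.sq_sqrt (by norm_num)
  have := (one_add_four_mul_sq_pos x).ne'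
  generalize √3 = s at hs
  field_simp
  linear_combination (-(16 * (4 * x ^ 2 - 3) ^ 3 * (24 * x - 4 * s)) * 8 : ℝ) * hs

theorem ad_eq (hx : √3 / 2 ≤ x) (hj : jd d = (jOfCoord x : ℂ)) : ad d = x := by
  rw [ad, sqrtC_const_sub_jd hx hj, cbrtC_betad_sub hx hj, cbrtC_betad_add hx hj,
    show ((1 : ℂ) / 48) = ((1 / 48 : ℝ) : ℂ) by push_cast; rfl]
  norm_cast
  have := (one_add_four_mul_sq_pos x).ne'
  field_simp
  ring

theorem bd_eq (hx : √3 / 2 ≤ x) (hj : jd d = (jOfCoord x : ℂ)) : bd d = x := by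
  have h0 := nonneg_of_sqrt_three_le hx
  have h : sqrtC (((√3 : ℝ) * (cbrtC (betad d - 24 * (√3 : ℝ) * jd d)
      - cbrtC (betad d + 24 * (√3 : ℝ) * jd d)) + 24) ^ 2 + 1152 - 9 * jd d) =
      ((48 * x : ℝ) : ℂ) := by
    refine sqrtC_eq_of_sq_eq (by positivity) ?_
    rw [cbrtC_betad_sub hx hj, cbrtC_betad_add hx hj, hj]
    norm_cast
    rw [jOfCoord, show √3 * (4 * (4 * x ^ 2 - 3) * (4 * x + 2 * √3) / (1 + 4 * x ^ 2)
        - 4 * (4 * x ^ 2 - 3) * (4 * x - 2 * √3) / (1 + 4 * x ^ 2)) =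
        √3 ^ 2 * (16 * (4 * x ^ 2 - 3) / (1 + 4 * x ^ 2)) by ring,
      Real.sq_sqrt (by norm_num : (0 : ℝ) ≤ 3)]
    have := (one_add_four_mul_sq_pos x).ne'
    field_simp
    ring
  rw [bd, h]
  push_cast
  ring

/-- The quartic vanishes at x = √3/2, and its cofactor has nonnegative coefficients. -/
lemma quartic_sub_nonneg (hx : √3 / 2 ≤ x) :
    0 ≤ (4 * x ^ 2) ^ 2 + 6 * (4 * x ^ 2) - 3 - 16 * √3 * x := by
  have h0 := nonneg_of_sqrt_three_le hx
  have hs : √3 ^ 2 = 3 := Real.sq_sqrt (by norm_num)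
  have h1 : 0 ≤ 2 * x - √3 := by linarith
  have h2 : (4 * x ^ 2) ^ 2 + 6 * (4 * x ^ 2) - 3 - 16 * √3 * x =
      (2 * x - √3) * (8 * x ^ 3 + √3 * (4 * x ^ 2) + 18 * x + √3) := by
    linear_combination (4 * x ^ 2 + 1) * hs
  rw [h2]
  positivity

lemma cbrtC_td_sub (hx : √3 / 2 ≤ x) (hj : jd d = (jOfCoord x : ℂ)) :
    cbrtC (-884736 * jd d + 2304 * jd d ^ 2 - jd d ^ 3 - 12288 * (√3 : ℝ) * betad d) =
      ((64 * (4 * x ^ 2 - 3) * ((4 * x ^ 2) ^ 2 + 6 * (4 * x ^ 2) - 3 - 16 * √3 * x) /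
        (1 + 4 * x ^ 2) ^ 2 : ℝ) : ℂ) := by
  have h3 := four_mul_sq_sub_three_nonneg hx
  have h4 := quartic_sub_nonneg hx
  refine cbrtC_eq_of_cube_eq (by positivity) ?_
  rw [betad_eq hx hj, hj]
  norm_cast
  rw [jOfCoord]
  have hs : √3 ^ 2 = 3 := Real.sq_sqrt (by norm_num)
  have := (one_add_four_mul_sq_pos x).ne'
  clear h4
  generalize √3 = s at hs
  push_cast
  field_simp
  linear_combination (-(64 ^ 3 * (4 * x ^ 2 - 3) ^ 3 * (768 * ((4 * x ^ 2) ^ 2 + 6 * (4 * x ^ 2) - 3)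
    * x ^ 2 - 4096 * x ^ 3 * s)) : ℝ) * hs

lemma cbrtC_td_add (hx : √3 / 2 ≤ x) (hj : jd d = (jOfCoord x : ℂ)) :
    cbrtC (-884736 * jd d + 2304 * jd d ^ 2 - jd d ^ 3 + 12288 * (√3 : ℝ) * betad d) =
      ((64 * (4 * x ^ 2 - 3) * ((4 * x ^ 2) ^ 2 + 6 * (4 * x ^ 2) - 3 + 16 * √3 * x) /
        (1 + 4 * x ^ 2) ^ 2 : ℝ) : ℂ) := by
  have h0 := nonneg_of_sqrt_three_le hx
  have h3 := four_mul_sq_sub_three_nonneg hx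
  have h4 : 0 ≤ (4 * x ^ 2) ^ 2 + 6 * (4 * x ^ 2) - 3 + 16 * √3 * x := by
    have : 0 ≤ √3 * x := by positivity
    linarith [quartic_sub_nonneg hx]
  refine cbrtC_eq_of_cube_eq (by positivity) ?_
  rw [betad_eq hx hj, hj]
  norm_cast
  rw [jOfCoord]
  have hs : √3 ^ 2 = 3 := Real.sq_sqrt (by norm_num)
  have := (one_add_four_mul_sq_pos x).ne'
  clear h4
  generalize √3 = s at hs
  push_cast
  field_simp
  linear_combination (-(64 ^ 3 * (4 * x ^ 2 - 3) ^ 3 * (768 * ((4 * x ^ 2) ^ 2 + 6 * (4 * x ^ 2) - 3)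
    * x ^ 2 + 4096 * x ^ 3 * s)) : ℝ) * hs

theorem cd_eq (hx : √3 / 2 ≤ x) (hj : jd d = (jOfCoord x : ℂ)) : cd d = x := by
  have h0 := nonneg_of_sqrt_three_le hx
  have h : sqrtC (-2304 * td d + 1728 - 3 * jd d) = ((48 * x : ℝ) : ℂ) := by
    refine sqrtC_eq_of_sq_eq (by positivity) ?_
    rw [td, cbrtC_td_sub hx hj, cbrtC_td_add hx hj, hj,
      show (-(1 / 768) : ℂ) = ((-(1 / 768) : ℝ) : ℂ) by push_cast; rfl]
    norm_cast
    rw [jOfCoord]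
    have := (one_add_four_mul_sq_pos x).ne'
    push_cast
    field_simp
    ring
  rw [cd, h]
  push_cast
  ring

end Radicals

/-! ### Lambda at (1 + √-d)/2 and on its orbit. -/

section SpecialPoints

variable {d : ℝ}

lemma sqrtNeg_im (d : ℝ) : (sqrtNeg d).im = √d := by simp [sqrtNeg]

lemma conj_sqrtNeg (d : ℝ) : (starRingEnd ℂ) (sqrtNeg d) = -sqrtNeg d := by simp [sqrtNeg]

lemma half_one_add_sqrtNeg_im_pos (hd : 0 < d) : 0 < ((1 + sqrtNeg d) / 2).im := by
  have h : ((1 + sqrtNeg d) / 2).im = √d / 2 := by simp [sqrtNeg_im]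
  rw [h]
  positivity

lemma cexp_half_one_add_sqrtNeg (d : ℝ) :
    cexp (Real.pi * I * ((1 + sqrtNeg d) / 2)) = I * (Real.exp (-(Real.pi * √d / 2)) : ℝ) := by
  rw [sqrtNeg, show Real.pi * I * ((1 + I * (√d : ℝ)) / 2) =
    Real.pi / 2 * I + ((-(Real.pi * √d / 2) : ℝ) : ℂ) by
      push_cast; linear_combination (Real.pi * (√d : ℝ) / 2 : ℂ) * I_sq,
    exp_add, exp_pi_div_two_mul_I, ofReal_exp]

/-- Places the nomes for all d ≥ 3 in the range of the estimates; numerically e^2.7 = e³ · e^(-0.3)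
≥ 20 · 0.7. -/
lemma exp_neg_pi_sqrt_three_le : Real.exp (-(Real.pi * √3 / 2)) ≤ 1 / 14 := by
  have h1 : (1.732 : ℝ) ≤ √3 := Real.le_sqrt_of_sq_le (by norm_num)
  have h2 : (2.7 : ℝ) ≤ Real.pi * √3 / 2 := by nlinarith [Real.pi_gt_d2]
  have h3 : (14 : ℝ) ≤ Real.exp (2.7) := by
    have := Real.exp_one_gt_d9
    have h := Real.add_one_le_exp (-0.3 : ℝ)
    rw [show (2.7 : ℝ) = 1 + 1 + 1 + -0.3 by norm_num, Real.exp_add, Real.exp_add, Real.exp_add]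
    have h6 : (20 : ℝ) ≤ Real.exp 1 * Real.exp 1 * Real.exp 1 := by
      calc (20 : ℝ) ≤ 2.7182 * 2.7182 * 2.7182 := by norm_num
        _ ≤ _ := by gcongr <;> linarith
    calc (14 : ℝ) = 20 * (-0.3 + 1) := by norm_num
      _ ≤ _ := by gcongr
  rw [Real.exp_neg, one_div]
  exact inv_anti₀ (by norm_num) (h3.trans (Real.exp_le_exp.mpr h2))

lemma conj_lam_half_one_add_sqrtNeg (hd : 0 < d) :
    (starRingEnd ℂ) (lam ((1 + sqrtNeg d) / 2)) =
      lam ((1 + sqrtNeg d) / 2) / (lam ((1 + sqrtNeg d) / 2) - 1) := by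
  have hτ := half_one_add_sqrtNeg_im_pos hd
  rw [← lam_neg_conj hτ, ← lam_sub_one hτ]
  congr 1
  rw [map_div₀, map_add, conj_sqrtNeg, map_one, map_ofNat]
  ring

/-- Here τ = exp(πi/3) satisfies -1/τ = τ - 1, so 1 - L = L/(L - 1) = L̄, whence L L̄ = 1. -/
lemma norm_lam_half_one_add_sqrtNeg_three : ‖lam ((1 + sqrtNeg 3) / 2)‖ = 1 := by
  have hτ := half_one_add_sqrtNeg_im_pos (d := 3) (by norm_num)
  have hc := conj_lam_half_one_add_sqrtNeg (d := 3) (by norm_num)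
  have h1 := lam_neg_one_div hτ
  have hs : sqrtNeg 3 ^ 2 = -3 := by
    rw [sqrtNeg, mul_pow, I_sq, ← ofReal_pow, Real.sq_sqrt (by norm_num)]
    norm_num
  have h0 : (1 + sqrtNeg 3) / 2 ≠ 0 := fun h => by simp [h] at hτ
  have hfix : -1 / ((1 + sqrtNeg 3) / 2) = (1 + sqrtNeg 3) / 2 - 1 := by
    rw [div_eq_iff h0]
    linear_combination -hs / 4
  rw [hfix, lam_sub_one hτ, ← hc] at h1
  have n1 := one_sub_lam_ne_zero hτ
  have n1' : lam ((1 + sqrtNeg 3) / 2) - 1 ≠ 0 := by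
    rw [← neg_sub]; exact neg_ne_zero.mpr n1
  have h2 : ((‖lam ((1 + sqrtNeg 3) / 2)‖ ^ 2 : ℝ) : ℂ) = 1 := by
    rw [← normSq_eq_norm_sq, normSq_eq_conj_mul_self]
    rw [eq_div_iff n1', h1] at hc
    rw [h1]
    linear_combination hc
  have h3 : ‖lam ((1 + sqrtNeg 3) / 2)‖ ^ 2 = 1 := by exact_mod_cast h2
  exact (pow_eq_one_iff_of_nonneg (norm_nonneg _) two_ne_zero).mp h3

/-- For `d ≥ 3` the value `lam ((1 + √-d) / 2)` has the form `1 / (1 / 2 - i x)` with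
`x ≥ √3 / 2` real. -/
theorem exists_lam_half_one_add_sqrtNeg (hd : 3 ≤ d) :
    ∃ x : ℝ, √3 / 2 ≤ x ∧ lam ((1 + sqrtNeg d) / 2) = 1 / (1 / 2 - I * x) := by
  have hd0 : 0 < d := by linarith
  have hτ := half_one_add_sqrtNeg_im_pos hd0
  have hτ3 := half_one_add_sqrtNeg_im_pos (d := 3) (by norm_num)
  have hc := conj_lam_half_one_add_sqrtNeg hd0
  have n0 := lam_ne_zero hτ
  have n1 : lam ((1 + sqrtNeg d) / 2) - 1 ≠ 0 := by
    rw [← neg_sub]; exact neg_ne_zero.mpr (one_sub_lam_ne_zero hτ)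
  have hle : Real.exp (-(Real.pi * √d / 2)) ≤ Real.exp (-(Real.pi * √3 / 2)) := by
    have := Real.sqrt_le_sqrt hd
    have := Real.pi_pos
    gcongr
  have him := lam_im_pos hτ (Real.exp_pos _) (hle.trans exp_neg_pi_sqrt_three_le)
    (cexp_half_one_add_sqrtNeg d)
  have hn := norm_lam_mono hτ hτ3 (Real.exp_pos _) hle exp_neg_pi_sqrt_three_le
    (cexp_half_one_add_sqrtNeg d) (cexp_half_one_add_sqrtNeg 3)
  rw [norm_lam_half_one_add_sqrtNeg_three] at hn
  set L := lam ((1 + sqrtNeg d) / 2)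
  have hN : 0 < normSq L := normSq_pos.mpr n0
  have hN1 : normSq L ≤ 1 := by
    rw [normSq_eq_norm_sq]
    exact pow_le_one₀ (norm_nonneg _) hn
  have hre : normSq L = 2 * L.re := by
    rw [eq_div_iff n1, mul_sub, ← normSq_eq_conj_mul_self, mul_one] at hc
    have := congrArg re hc
    simp only [sub_re, ofReal_re, conj_re] at this
    linarith
  have hN' : normSq L = L.re ^ 2 + L.im ^ 2 := by rw [normSq_apply]; ring
  -- The witness is x = -Im(1/L) = Im L/|L|².
  have hx0 : 0 < L.im / normSq L := by positivity
  have hx2 : 1 / 4 + (L.im / normSq L) ^ 2 = 1 / normSq L := by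
    field_simp
    nlinarith
  refine ⟨L.im / normSq L, ?_, ?_⟩
  · rw [div_le_iff₀ two_pos]
    refine Real.sqrt_le_iff.mpr ⟨by positivity, ?_⟩
    have : 1 ≤ 1 / normSq L := by rwa [le_div_iff₀ hN, one_mul]
    nlinarith
  · rw [one_div, eq_comm, inv_eq_iff_eq_inv, inv_def]
    apply Complex.ext
    · simp
      field_simp
      linarith
    · simp
      field_simp

/-- The values of `lam` on the orbit of `(1 + √-d) / 2` in terms of the one at that point. -/
theorem lam_orbit (hd : 0 < d) {x : ℝ}
    (h : lam ((1 + sqrtNeg d) / 2) = 1 / (1 / 2 - I * x)) :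
    lam ((sqrtNeg d - 1) / (sqrtNeg d + 1)) = 1 / 2 + I * x ∧
    lam (2 / (1 - sqrtNeg d)) = (I * x - 1 / 2) / (I * x + 1 / 2) ∧
    lam (-(2 / (1 + sqrtNeg d))) = (I * x + 1 / 2) / (I * x - 1 / 2) ∧
    lam (-((sqrtNeg d + 1) / (sqrtNeg d - 1))) = 1 / 2 - I * x ∧
    lam ((-1 + sqrtNeg d) / 2) = 1 / (1 / 2 + I * x) := by
  have n1 : (1 / 2 - I * x : ℂ) ≠ 0 := fun h => by simpa using congrArg re h
  have n2 : (1 / 2 + I * x : ℂ) ≠ 0 := fun h => by simpa using congrArg re h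
  have n3 : (I * x + 1 / 2 : ℂ) ≠ 0 := by rwa [add_comm]
  have n4 : (I * x - 1 / 2 : ℂ) ≠ 0 := by rw [← neg_sub]; exact neg_ne_zero.mpr n1
  have hs : 0 < (sqrtNeg d).im := by rw [sqrtNeg_im]; positivity
  have s1 : sqrtNeg d + 1 ≠ 0 := fun h => by
    have := congrArg im h
    simp only [add_im, one_im, add_zero, zero_im] at this
    linarith
  have s2 : sqrtNeg d - 1 ≠ 0 := fun h => by
    have := congrArg im h
    simp only [sub_im, one_im, sub_zero, zero_im] at this
    linarith
  have s3 : 1 - sqrtNeg d ≠ 0 := by rw [← neg_sub]; exact neg_ne_zero.mpr s2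
  have s4 : 1 + sqrtNeg d ≠ 0 := by rwa [add_comm]
  have hτ := half_one_add_sqrtNeg_im_pos hd
  -- With τ = (1 + √-d)/2 the five points are τ - 1, -1/τ, -1/(τ - 1), -1/τ + 1 and -1/(τ - 1) - 1.
  have e6 : (-1 + sqrtNeg d) / 2 = (1 + sqrtNeg d) / 2 - 1 := by ring
  have hσ : 0 < ((-1 + sqrtNeg d) / 2).im := by rw [e6]; simpa using hτ
  have e4 : -(2 / (1 + sqrtNeg d)) = -1 / ((1 + sqrtNeg d) / 2) := by field_simp
  have e3 : 2 / (1 - sqrtNeg d) = -1 / ((-1 + sqrtNeg d) / 2) := by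
    rw [show (-1 + sqrtNeg d) / 2 = -((1 - sqrtNeg d) / 2) by ring]
    field_simp
  have e2 : (sqrtNeg d - 1) / (sqrtNeg d + 1) = -(2 / (1 + sqrtNeg d)) + 1 := by
    rw [add_comm 1 (sqrtNeg d)]
    field_simp
    ring
  have e5 : -((sqrtNeg d + 1) / (sqrtNeg d - 1)) = 2 / (1 - sqrtNeg d) - 1 := by
    rw [← neg_sub (sqrtNeg d) 1]
    field_simp
    ring
  have h6 : lam ((-1 + sqrtNeg d) / 2) = 1 / (1 / 2 + I * x) := by
    rw [e6, lam_sub_one hτ, h,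
      show 1 / (1 / 2 - I * (x : ℂ)) - 1 = (1 / 2 + I * x) / (1 / 2 - I * x) by
        rw [div_sub_one n1]; ring, div_div_div_cancel_right₀ n1]
  have h4 : lam (-(2 / (1 + sqrtNeg d))) = (I * x + 1 / 2) / (I * x - 1 / 2) := by
    rw [e4, lam_neg_one_div hτ, h, one_sub_div n1, ← neg_sub (I * (x : ℂ)), div_neg, ← neg_div]
    ring
  have h3 : lam (2 / (1 - sqrtNeg d)) = (I * x - 1 / 2) / (I * x + 1 / 2) := by
    rw [e3, lam_neg_one_div hσ, h6, one_sub_div n2, add_comm (1 / 2 : ℂ)]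
    ring
  have i4 : 0 < (-(2 / (1 + sqrtNeg d))).im := by rw [e4]; exact neg_one_div_im_pos hτ
  have i3 : 0 < (2 / (1 - sqrtNeg d)).im := by rw [e3]; exact neg_one_div_im_pos hσ
  refine ⟨?_, h3, h4, ?_, h6⟩
  · rw [e2, lam_add_one i4, h4, div_sub_one n4,
      show I * (x : ℂ) + 1 / 2 - (I * x - 1 / 2) = 1 by ring, div_div_div_cancel_right₀ n4]
    ring
  · rw [e5, lam_sub_one i3, h3, div_sub_one n3,
      show I * (x : ℂ) - 1 / 2 - (I * x + 1 / 2) = -1 by ring, div_div_div_cancel_right₀ n3]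
    ring

end SpecialPoints

end EllipticLambda

end

theorem theorem1 (d : ℝ) (hd : 3 ≤ d) :
    ((EllipticLambda.ad d).im = 0 ∧ (EllipticLambda.bd d).im = 0 ∧ (EllipticLambda.cd d).im = 0) ∧
    (EllipticLambda.lam ((1 + EllipticLambda.sqrtNeg d) / 2) =
        1 / (1 / 2 - Complex.I * EllipticLambda.ad d) ∧
      EllipticLambda.lam ((1 + EllipticLambda.sqrtNeg d) / 2) =
        1 / (1 / 2 - Complex.I * EllipticLambda.bd d) ∧
      EllipticLambda.lam ((1 + EllipticLambda.sqrtNeg d) / 2) =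
        1 / (1 / 2 - Complex.I * EllipticLambda.cd d)) ∧
    (EllipticLambda.lam ((EllipticLambda.sqrtNeg d - 1) / (EllipticLambda.sqrtNeg d + 1)) =
        1 / 2 + Complex.I * EllipticLambda.ad d ∧
      EllipticLambda.lam ((EllipticLambda.sqrtNeg d - 1) / (EllipticLambda.sqrtNeg d + 1)) =
        1 / 2 + Complex.I * EllipticLambda.bd d ∧
      EllipticLambda.lam ((EllipticLambda.sqrtNeg d - 1) / (EllipticLambda.sqrtNeg d + 1)) =
        1 / 2 + Complex.I * EllipticLambda.cd d) ∧
    (EllipticLambda.lam (2 / (1 - EllipticLambda.sqrtNeg d)) =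
        (Complex.I * EllipticLambda.ad d - 1 / 2) / (Complex.I * EllipticLambda.ad d + 1 / 2) ∧
      EllipticLambda.lam (2 / (1 - EllipticLambda.sqrtNeg d)) =
        (Complex.I * EllipticLambda.bd d - 1 / 2) / (Complex.I * EllipticLambda.bd d + 1 / 2) ∧
      EllipticLambda.lam (2 / (1 - EllipticLambda.sqrtNeg d)) =
        (Complex.I * EllipticLambda.cd d - 1 / 2) / (Complex.I * EllipticLambda.cd d + 1 / 2)) ∧
    (EllipticLambda.lam (-(2 / (1 + EllipticLambda.sqrtNeg d))) =
        (Complex.I * EllipticLambda.ad d + 1 / 2) / (Complex.I * EllipticLambda.ad d - 1 / 2) ∧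
      EllipticLambda.lam (-(2 / (1 + EllipticLambda.sqrtNeg d))) =
        (Complex.I * EllipticLambda.bd d + 1 / 2) / (Complex.I * EllipticLambda.bd d - 1 / 2) ∧
      EllipticLambda.lam (-(2 / (1 + EllipticLambda.sqrtNeg d))) =
        (Complex.I * EllipticLambda.cd d + 1 / 2) / (Complex.I * EllipticLambda.cd d - 1 / 2)) ∧
    (EllipticLambda.lam (-((EllipticLambda.sqrtNeg d + 1) / (EllipticLambda.sqrtNeg d - 1))) =
        1 / 2 - Complex.I * EllipticLambda.ad d ∧
      EllipticLambda.lam (-((EllipticLambda.sqrtNeg d + 1) / (EllipticLambda.sqrtNeg d - 1))) =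
        1 / 2 - Complex.I * EllipticLambda.bd d ∧
      EllipticLambda.lam (-((EllipticLambda.sqrtNeg d + 1) / (EllipticLambda.sqrtNeg d - 1))) =
        1 / 2 - Complex.I * EllipticLambda.cd d) ∧
    (EllipticLambda.lam ((-1 + EllipticLambda.sqrtNeg d) / 2) =
        1 / (1 / 2 + Complex.I * EllipticLambda.ad d) ∧
      EllipticLambda.lam ((-1 + EllipticLambda.sqrtNeg d) / 2) =
        1 / (1 / 2 + Complex.I * EllipticLambda.bd d) ∧
      EllipticLambda.lam ((-1 + EllipticLambda.sqrtNeg d) / 2) =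
        1 / (1 / 2 + Complex.I * EllipticLambda.cd d)) := by
  obtain ⟨x, hx, h⟩ := EllipticLambda.exists_lam_half_one_add_sqrtNeg hd
  have hj := EllipticLambda.jd_eq_jOfCoord h
  obtain ⟨h2, h3, h4, h5, h6⟩ := EllipticLambda.lam_orbit (by linarith) h
  rw [EllipticLambda.ad_eq hx hj, EllipticLambda.bd_eq hx hj, EllipticLambda.cd_eq hx hj]
  exact ⟨by simp, ⟨h, h, h⟩, ⟨h2, h2, h2⟩, ⟨h3, h3, h3⟩, ⟨h4, h4, h4⟩, ⟨h5, h5, h5⟩, h6, h6, h6⟩
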